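/- All logarithms are base $2$. For $n\ge 1$, the $n$-qubit Toffoli gate is $\mathrm{Toff}_n|x\rangle|b\rangle=|x\rangle|b\oplus(x_1\wedge\cdots\wedge x_{n-1})\rangle$ for $x\in\{0,1\}^{n-1}$, $b\in\{0,1\}$; for $m\le 0$, $\mathrm{Toff}_m$ denotes the identity on zero qubits. A Clifford+$T$ circuit is a finite sequence of the gates $H$, $S$, $\mathrm{CNOT}$, $T$. Such a circuit $V$ on $n$ input qubits and $a$ ancilla qubits initialized to $|0^a\rangle$ defines the channel $\mathcal E_V(\rho)=\mathrm{Tr}_{\mathrm{anc}}[V(\rho\otimes|0^a\rangle\langle 0^a|)V^\dagger]$. For channels on $n$ qubits let $D_\diamond(\mathcal E_1,\mathcal E_2)=\sup\tfrac12\|(\mathcal E_1\otimes I_\ell)(\rho)-(\mathcal E_2\otimes I_\ell)(\rho)\|_1$, the supremum being over $\ell\in\mathbb N$ and density matrices $\rho$ on $n+\ell$ qubits; a unitary $U$ is identified with the channel $\rho\mapsto U\rho U^\dagger$. The unitary $T$-count $\mathcal T^{\mathrm{unitary}}_\epsilon(U)$ is the minimum number of $T$ gates in a Clifford+$T$ circuit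 $V$ (with any number of ancillas) with $D_\diamond(\mathcal E_V,U)\le\epsilon$. The mixed $T$-count $\mathcal T^{\mathrm{mixed}}_\epsilon(U)$ is the minimum $k$ such that there are a probability distribution $(p_i)$ and Clifford+$T$ circuits $V_i$ on a common number of ancillas, each with at most $k$ $T$ gates, with $D_\diamond\bigl(\sum_i p_i\mathcal E_{V_i},U\bigr)\le\epsilon$. Theorem. For every positive integer $n$ and every $\epsilon>0$, $$\mathcal T^{\mathrm{mixed}}_\epsilon(\mathrm{Toff}_n)\le \mathcal T^{\mathrm{unitary}}_0\bigl(\mathrm{Toff}_{\lceil\log(1/\epsilon)\rceil+3}\bigr).$$ Moreover the right-hand side, which does not depend on $n$, is $O(\log(1/\epsilon))$: there is an absolute constant $C$ such that for every $\epsilon>0$ it is finite and at most $C\max\{1,\log(1/\epsilon)\}$; in particular it is at most $C\log(1/\epsilon)$ for all $0<\epsilon\le 1/2$. -/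

import Mathlib

open scoped Matrix ENNReal ComplexOrder

noncomputable section

namespace CliffordT

/-- Computational basis labels of a register whose qubits are indexed by `Q`. -/
abbrev Bits (Q : Type) : Type := Q → Bool

/-- Operators on a register whose qubits are indexed by `Q`. -/
abbrev Op (Q : Type) : Type := Matrix (Bits Q) (Bits Q) ℂ

/-! ### Trace distance and diamond distance -/

/-- The trace norm `‖A‖₁ = Tr √(A† A)`. -/
def traceNorm {α : Type} [Fintype α] [DecidableEq α] (A : Matrix α α ℂ) : ℝ :=
  (Matrix.trace (cfc Real.sqrt (Aᴴ * A))).re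

/-- The trace distance `D(ρ, σ) = ½ ‖ρ - σ‖₁`. -/
def traceDist {α : Type} [Fintype α] [DecidableEq α] (ρ σ : Matrix α α ℂ) : ℝ :=
  (1 / 2) * traceNorm (ρ - σ)

/-- Density matrices. -/
def IsDensity {α : Type} [Fintype α] (ρ : Matrix α α ℂ) : Prop :=
  ρ.PosSemidef ∧ ρ.trace = 1

/-- Linear maps on operators of an `n`-qubit register; quantum channels are among them. -/
abbrev SuperOp (n : ℕ) : Type := Op (Fin n) →ₗ[ℂ] Op (Fin n)

/-- `(Φ ⊗ I_ℓ)(ρ)` for an operator `ρ` on `n + ℓ` qubits: `Φ` acts on each `n`-qubit block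
`(I ⊗ ⟨z|) ρ (I ⊗ |z'⟩)`. -/
def SuperOp.tensorId {n : ℕ} (Φ : SuperOp n) (ℓ : ℕ)
    (ρ : Matrix (Bits (Fin n) × Bits (Fin ℓ)) (Bits (Fin n) × Bits (Fin ℓ)) ℂ) :
    Matrix (Bits (Fin n) × Bits (Fin ℓ)) (Bits (Fin n) × Bits (Fin ℓ)) ℂ :=
  Matrix.of fun u v => Φ (Matrix.of fun x y => ρ (x, u.2) (y, v.2)) u.1 v.1

/-- The diamond distance: the supremum of `D((Φ ⊗ I_ℓ)(ρ), (Ψ ⊗ I_ℓ)(ρ))` over all `ℓ` and all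
density matrices `ρ` on `n + ℓ` qubits. -/
def diamondDist {n : ℕ} (Φ Ψ : SuperOp n) : ℝ≥0∞ :=
  ⨆ (ℓ : ℕ) (ρ : Matrix (Bits (Fin n) × Bits (Fin ℓ)) (Bits (Fin n) × Bits (Fin ℓ)) ℂ)
    (_ : IsDensity ρ), ENNReal.ofReal (traceDist (Φ.tensorId ℓ ρ) (Ψ.tensorId ℓ ρ))

/-- The map `Φ_U(ρ) = U ρ U†`. -/
def unitaryChannel {n : ℕ} (U : Op (Fin n)) : SuperOp n where
  toFun ρ := U * ρ * Uᴴ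
  map_add' ρ σ := by rw [Matrix.mul_add, Matrix.add_mul]
  map_smul' r ρ := by simp

/-! ### Unitary Clifford+T circuits -/

/-- The elementary gates: the Clifford generators `H`, `S`, `CNOT`, and the gate `T`. -/
inductive Gate (Q : Type) : Type
  | H (q : Q) : Gate Q
  | S (q : Q) : Gate Q
  | CNOT (control target : Q) (hne : control ≠ target) : Gate Q
  | T (q : Q) : Gate Q

/-- The one-qubit Hadamard matrix. -/
def hadamard : Matrix Bool Bool ℂ :=
  Matrix.of fun b b' => ((Real.sqrt 2)⁻¹ : ℂ) * (if b && b' then -1 else 1)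

/-- The one-qubit phase matrix `diag(1, e^{iθ})`. -/
def phase (θ : ℝ) : Matrix Bool Bool ℂ :=
  Matrix.diagonal fun b => if b then Complex.exp (θ * Complex.I) else 1

/-- The operator that applies the one-qubit matrix `M` to qubit `q`. -/
def onQubit {Q : Type} [Fintype Q] [DecidableEq Q] (q : Q) (M : Matrix Bool Bool ℂ) : Op Q :=
  Matrix.of fun w v => if ∀ r, r ≠ q → w r = v r then M (w q) (v q) else 0

/-- The operator sending `|v⟩` to `|f v⟩`. -/
def basisMap {Q : Type} [Fintype Q] [DecidableEq Q] (f : Bits Q → Bits Q) : Op Q :=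
  Matrix.of fun w v => if w = f v then 1 else 0

/-- The operator of a gate, acting on the whole register. -/
def Gate.toOp {Q : Type} [Fintype Q] [DecidableEq Q] : Gate Q → Op Q
  | .H q => onQubit q hadamard
  | .S q => onQubit q (phase (Real.pi / 2))
  | .CNOT c t _ => basisMap fun v => Function.update v t (xor (v t) (v c))
  | .T q => onQubit q (phase (Real.pi / 4))

/-- A Clifford+T circuit: a list of gates, the head of the list being applied first. -/
abbrev Circuit (Q : Type) : Type := List (Gate Q)

/-- The unitary implemented by a circuit. -/
def Circuit.toOp {Q : Type} [Fintype Q] [DecidableEq Q] : Circuit Q → Op Q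
  | [] => 1
  | g :: c => Circuit.toOp c * g.toOp

/-- The number of `T` gates of a circuit. -/
def Circuit.tCount {Q : Type} : Circuit Q → ℕ
  | [] => 0
  | .T _ :: c => Circuit.tCount c + 1
  | _ :: c => Circuit.tCount c

/-- `ρ ⊗ |0^a⟩⟨0^a|`. -/
def addAncillas {n : ℕ} (a : ℕ) (ρ : Op (Fin n)) : Op (Fin n ⊕ Fin a) :=
  Matrix.of fun w v =>
    if (∀ j, w (Sum.inr j) = false) ∧ (∀ j, v (Sum.inr j) = false) then
      ρ (fun i => w (Sum.inl i)) (fun i => v (Sum.inl i))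
    else 0

/-- The partial trace over the ancilla register. -/
def traceAncillas {n a : ℕ} (A : Op (Fin n ⊕ Fin a)) : Op (Fin n) :=
  Matrix.of fun x y => ∑ z : Bits (Fin a), A (Sum.elim x z) (Sum.elim y z)

/-- The channel `ρ ↦ Tr_anc[V (ρ ⊗ |0^a⟩⟨0^a|) V†]` of a circuit `V` with `a` ancillas. -/
def Circuit.channel {n a : ℕ} (c : Circuit (Fin n ⊕ Fin a)) : SuperOp n where
  toFun ρ := traceAncillas (c.toOp * addAncillas a ρ * c.toOpᴴ)
  map_add' ρ σ := by
    have h : addAncillas a (ρ + σ) = addAncillas a ρ + addAncillas a σ := by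
      ext w v
      simp only [addAncillas, Matrix.of_apply, Matrix.add_apply]
      split_ifs <;> simp
    rw [h, Matrix.mul_add, Matrix.add_mul]
    ext x y
    simp [traceAncillas, Finset.sum_add_distrib]
  map_smul' r ρ := by
    have h : addAncillas a (r • ρ) = r • addAncillas a ρ := by
      ext w v
      simp only [addAncillas, Matrix.of_apply, Matrix.smul_apply]
      split_ifs <;> simp
    rw [h, Matrix.mul_smul, Matrix.smul_mul]
    ext x y
    simp [traceAncillas, Finset.mul_sum]

/-- The `ε`-approximate unitary `T`-count of an `n`-qubit unitary `U`: the least number of `T` gates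
of a circuit, with any number of ancillas, whose channel is `ε`-close to `U` in diamond distance
(`⊤` if there is none). -/
def unitaryTCount {n : ℕ} (ε : ℝ) (U : Op (Fin n)) : ℕ∞ :=
  ⨅ (a : ℕ) (c : Circuit (Fin n ⊕ Fin a))
    (_ : diamondDist c.channel (unitaryChannel U) ≤ ENNReal.ofReal ε), (c.tCount : ℕ∞)

/-! ### Mixed Clifford+T circuits -/

/-- A mixed Clifford+T circuit on `n` qubits: a probability distribution over finitely many
Clifford+T circuits that share an ancilla register. -/
structure MixedCircuit (n : ℕ) where
  anc : ℕ
  size : ℕ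
  prob : Fin size → ℝ
  prob_nonneg : ∀ i, 0 ≤ prob i
  prob_sum : ∑ i, prob i = 1
  circuit : Fin size → Circuit (Fin n ⊕ Fin anc)

/-- The channel `ρ ↦ ∑ᵢ pᵢ Tr_anc[Vᵢ (ρ ⊗ |0^a⟩⟨0^a|) Vᵢ†]`. -/
def MixedCircuit.channel {n : ℕ} (M : MixedCircuit n) : SuperOp n :=
  ∑ i, (M.prob i : ℂ) • (M.circuit i).channel

/-- The maximal number of `T` gates of the circuits in the mixture. -/
def MixedCircuit.tCount {n : ℕ} (M : MixedCircuit n) : ℕ :=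
  Finset.univ.sup fun i => (M.circuit i).tCount

/-- The `ε`-approximate mixed unitary `T`-count of an `n`-qubit unitary `U`: the least `T`-count of
a mixed circuit whose channel is `ε`-close to `U` in diamond distance (`⊤` if there is none). -/
def mixedTCount {n : ℕ} (ε : ℝ) (U : Op (Fin n)) : ℕ∞ :=
  ⨅ (M : MixedCircuit n)
    (_ : diamondDist M.channel (unitaryChannel U) ≤ ENNReal.ofReal ε), (M.tCount : ℕ∞)

/-! ### The Toffoli gate -/

/-- The `n`-qubit Toffoli gate `|x⟩|b⟩ ↦ |x⟩|b ⊕ (x₁ ∧ ⋯ ∧ xₙ₋₁)⟩`; the target is the last qubit.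
For `n = 0` it is the identity on the empty register. -/
def toffoli (n : ℕ) : Op (Fin n) :=
  basisMap fun v i =>
    if (i : ℕ) + 1 = n then xor (v i) (decide (∀ j : Fin n, (j : ℕ) + 1 < n → v j = true)) else v i

end CliffordT

end

/-!
# Mixed Clifford+T circuits for the Toffoli gate

A Toffoli gate flips its target when no control is zero. This condition can be tested at random:
draw `m` independent uniform subsets of the controls and check that each contains an even number of
zeros. An all-one input passes all checks; any other input passes all of them with probability
exactly `q = 2⁻ᵐ` (`sum_forall_check`). For a fixed choice of subsets, the checks are computed by
CNOT and NOT gates into `m` ancillas, an `(m + 1)`-qubit Toffoli gate controlled by those ancillas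
flips the target, and the checks are uncomputed. This costs no more `T` gates than an exact circuit
for the `(m + 1)`-qubit Toffoli gate. That circuit is known only through its channel, so its own
ancillas may end in an arbitrary state; `channel_conj_toffoli` therefore uses nothing but the action
of the channel on matrix units.

Averaged over the subsets, the resulting unitaries `A` satisfy `𝔼 A = (1 - q) U + q B`, where `U` is
the Toffoli gate and `B` the NOT gate on its target (`average_controlledFlip`). Because the average
is taken on amplitudes, the averaged channel is within `4 q` of `U` (`traceDist_mixture_le`): with
`K = U - A`,
`𝔼 A ρ A† - U ρ U† = 𝔼 K ρ K† - q ((U - B) ρ U† + U ρ (U - B)†)`,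
and the right-hand side is a difference of two positive matrices of total trace at most `8 q`.
Choosing `m = ⌈log (1/ε)⌉ + 2` gives `4 q ≤ ε`.

The bound on the exact `T`-count comes from the usual ladder: with three-qubit Toffoli gates of
`T`-count seven, the conjunctions of the first `i` controls are written into ancillas one after the
other, the last is copied onto the target, and the ladder is undone (`exists_circuit_toffoli`).
-/

noncomputable section

namespace CliffordT

/-! ### Trace norm -/

section TraceNorm

variable {α : Type} [Fintype α] [DecidableEq α]

theorem trace_conjStarAlgAut (V : Matrix.unitaryGroup α ℂ) (A : Matrix α α ℂ) :
    (Unitary.conjStarAlgAut ℂ _ V A).trace = A.trace := by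
  rw [Unitary.conjStarAlgAut_apply, Matrix.trace_mul_comm, ← mul_assoc]
  simp

theorem trace_cfc {A : Matrix α α ℂ} (hA : A.IsHermitian) (f : ℝ → ℝ) :
    (cfc f A).trace = ∑ i, (f (hA.eigenvalues i) : ℂ) := by
  rw [hA.cfc_eq, Matrix.IsHermitian.cfc, trace_conjStarAlgAut, Matrix.trace_diagonal]
  rfl

theorem eq_zero_of_traceNorm_eq_zero {A : Matrix α α ℂ} (h : traceNorm A = 0) : A = 0 := by
  have hp := Matrix.posSemidef_conjTranspose_mul_self A
  rw [traceNorm, trace_cfc hp.1, ← Complex.ofReal_sum, Complex.ofReal_re,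
    Finset.sum_eq_zero_iff_of_nonneg fun i _ => Real.sqrt_nonneg _] at h
  have h0 : hp.1.eigenvalues = 0 := by
    funext i
    exact (Real.sqrt_eq_zero (hp.eigenvalues_nonneg i)).1 (h i (Finset.mem_univ i))
  exact Matrix.conjTranspose_mul_self_eq_zero.1 (hp.1.eigenvalues_eq_zero_iff.1 h0)

theorem traceNorm_eq_sum_abs_eigenvalues {A : Matrix α α ℂ} (hA : A.IsHermitian) :
    traceNorm A = ∑ i, |hA.eigenvalues i| := by
  have h : cfc Real.sqrt (Aᴴ * A) = cfc (fun x : ℝ => |x|) A := by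
    have hsq : Aᴴ * A = cfc (fun x : ℝ => x ^ 2) A := by
      rw [hA.eq, ← sq]
      exact (cfc_pow_id (R := ℝ) A 2 hA).symm
    rw [hsq, ← cfc_comp' Real.sqrt (fun x : ℝ => x ^ 2) A]
    simp only [Real.sqrt_sq_eq_abs]
  rw [traceNorm, h, trace_cfc hA, ← Complex.ofReal_sum, Complex.ofReal_re]

/-- In an eigenbasis of `P - N`, every eigenvalue is a difference of diagonal entries of `P` and
`N`, which are nonnegative. -/
theorem traceNorm_sub_le {P N : Matrix α α ℂ} (hP : P.PosSemidef) (hN : N.PosSemidef) :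
    traceNorm (P - N) ≤ (P.trace + N.trace).re := by
  have hX : (P - N).IsHermitian := hP.1.sub hN.1
  rw [traceNorm_eq_sum_abs_eigenvalues hX]
  set V := hX.eigenvectorUnitary
  have hd := hX.conjStarAlgAut_star_eigenvectorUnitary
  have hpsd : ∀ {M : Matrix α α ℂ}, M.PosSemidef →
      (Unitary.conjStarAlgAut ℂ _ (star V) M).PosSemidef := fun {M} hM => by
    rw [Unitary.conjStarAlgAut_apply]
    exact hM.mul_mul_conjTranspose_same _
  rw [← trace_conjStarAlgAut (star V) P, ← trace_conjStarAlgAut (star V) N, Matrix.trace,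
    Matrix.trace, ← Finset.sum_add_distrib, Complex.re_sum]
  refine Finset.sum_le_sum fun i _ => ?_
  have hi := congrArg Complex.re (congrFun (congrFun hd i) i)
  rw [map_sub] at hi
  simp only [Matrix.sub_apply, Complex.sub_re, Matrix.diagonal_apply_eq, Function.comp_apply] at hi
  have hp := (Complex.le_def.1 ((hpsd hP).diag_nonneg (i := i))).1
  have hn := (Complex.le_def.1 ((hpsd hN).diag_nonneg (i := i))).1
  simp only [Complex.zero_re] at hp hn
  simp only [Matrix.diag_apply, Complex.add_re]
  have hi' : hX.eigenvalues i = _ := hi.symm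
  rw [hi', abs_le]
  constructor <;> linarith

/-- If the average of the unitaries `A i` is `(1 - q) U + q B`, then averaging the conjugations by
the `A i` gives conjugation by `U` up to `4 q`: the deviation is linear in `q`, not of order
`√q`, because the first-order terms average before the norm is taken. -/
theorem traceDist_mixture_le {ι : Type} [Fintype ι] {p : ι → ℝ} (hp : ∀ i, 0 ≤ p i)
    (hp1 : ∑ i, p i = 1) {A : ι → Matrix α α ℂ} {U B : Matrix α α ℂ}
    (hA : ∀ i, (A i)ᴴ * A i = 1) (hU : Uᴴ * U = 1) (hB : Bᴴ * B = 1) {q : ℝ} (hq : 0 ≤ q)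
    (hmix : ∑ i, (p i : ℂ) • A i = (1 - q : ℂ) • U + (q : ℂ) • B)
    {ρ : Matrix α α ℂ} (hρ : IsDensity ρ) :
    traceDist (∑ i, (p i : ℂ) • (A i * ρ * (A i)ᴴ)) (U * ρ * Uᴴ) ≤ 4 * q := by
  obtain ⟨hρ0, hρ1⟩ := hρ
  set D := ∑ i, (p i : ℂ) • A i with hD
  set E := ∑ i, (p i : ℂ) • (A i * ρ * (A i)ᴴ) with hE
  have hp1' : ∑ i, (p i : ℂ) = 1 := by rw [← Complex.ofReal_sum, hp1, Complex.ofReal_one]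
  have hDH : Dᴴ = ∑ i, (p i : ℂ) • (A i)ᴴ := by
    simp [hD, Matrix.conjTranspose_sum, Matrix.conjTranspose_smul]
  have hexp : ∑ i, (p i : ℂ) • ((U - A i) * ρ * (U - A i)ᴴ)
      = U * ρ * Uᴴ - U * ρ * Dᴴ - D * ρ * Uᴴ + E := by
    have h1 : ∀ i, (p i : ℂ) • ((U - A i) * ρ * (U - A i)ᴴ)
        = (p i : ℂ) • (U * ρ * Uᴴ) - U * ρ * ((p i : ℂ) • (A i)ᴴ)
          - ((p i : ℂ) • A i) * ρ * Uᴴ + (p i : ℂ) • (A i * ρ * (A i)ᴴ) := fun i => by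
      simp only [Matrix.conjTranspose_sub, sub_mul, mul_sub, smul_mul_assoc, mul_smul_comm,
        smul_sub]
      abel
    rw [hDH]
    simp only [h1, Finset.sum_add_distrib, Finset.sum_sub_distrib, ← Finset.sum_smul, hp1',
      one_smul, ← Finset.mul_sum, ← Finset.sum_mul, hE, hD]
  have hDH' : Dᴴ = (1 - q : ℂ) • Uᴴ + (q : ℂ) • Bᴴ := by
    rw [hmix]; simp [Matrix.conjTranspose_smul]
  have hq2 : (0 : ℂ) ≤ (q / 2 : ℝ) := by exact_mod_cast (by positivity : 0 ≤ q / 2)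
  have hq3 : (0 : ℂ) ≤ (2 * q : ℝ) := by exact_mod_cast (by positivity : 0 ≤ 2 * q)
  set P := ∑ i, (p i : ℂ) • ((U - A i) * ρ * (U - A i)ᴴ)
    + ((q / 2 : ℝ) : ℂ) • ((U + B) * ρ * (U + B)ᴴ) with hPdef
  set N := ((2 * q : ℝ) : ℂ) • (U * ρ * Uᴴ) + ((q / 2 : ℝ) : ℂ) • ((U - B) * ρ * (U - B)ᴴ)
    with hNdef
  have hP : P.PosSemidef :=
    (Matrix.posSemidef_sum _ fun i _ => (hρ0.mul_mul_conjTranspose_same _).smul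
      (by exact_mod_cast hp i)).add ((hρ0.mul_mul_conjTranspose_same _).smul hq2)
  have hN : N.PosSemidef := ((hρ0.mul_mul_conjTranspose_same _).smul hq3).add
    ((hρ0.mul_mul_conjTranspose_same _).smul hq2)
  -- The cross terms `(U - B) ρ U† + U ρ (U - B)†` are completed to squares, weighted so that the
  -- traces of `P` and `N` add up to at most `8 q`.
  have hX : E - U * ρ * Uᴴ = P - N := by
    rw [hPdef, hNdef, hexp, hDH', hmix]
    simp only [Matrix.conjTranspose_sub, Matrix.conjTranspose_add, sub_mul, mul_sub, add_mul,
      mul_add, smul_mul_assoc, mul_smul_comm]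
    push_cast
    module
  have htr : ∀ {V : Matrix α α ℂ}, Vᴴ * V = 1 → (V * ρ * Vᴴ).trace = 1 := fun {V} hV => by
    rw [Matrix.trace_mul_comm, ← mul_assoc, hV, one_mul, hρ1]
  have htE : E.trace = 1 := by
    simp only [hE, Matrix.trace_sum, Matrix.trace_smul, htr (hA _), smul_eq_mul, mul_one, hp1']
  set z := (U * ρ * Bᴴ).trace + (B * ρ * Uᴴ).trace with hz
  have hz2 : -2 ≤ z.re := by
    have h := (Complex.le_def.1 (hρ0.mul_mul_conjTranspose_same (U + B)).trace_nonneg).1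
    simp only [Matrix.conjTranspose_add, add_mul, mul_add, Matrix.trace_add, htr hU, htr hB,
      Complex.add_re, Complex.one_re, Complex.zero_re] at h
    simp only [hz, Complex.add_re]
    linarith
  have htPN : P.trace + N.trace = ((6 * q : ℝ) : ℂ) - (q : ℂ) * z := by
    rw [hPdef, hNdef, hexp, hDH', hmix, hz]
    simp only [Matrix.conjTranspose_sub, Matrix.conjTranspose_add, sub_mul, mul_sub, add_mul,
      mul_add, smul_mul_assoc, mul_smul_comm, Matrix.trace_add, Matrix.trace_sub,
      Matrix.trace_smul, htr hU, htr hB, htE, smul_eq_mul]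
    push_cast
    ring
  have hle := traceNorm_sub_le hP hN
  rw [htPN, Complex.sub_re, Complex.ofReal_re, Complex.re_ofReal_mul] at hle
  rw [traceDist, hX]
  nlinarith

end TraceNorm

/-! ### Diamond distance -/

open scoped Kronecker

theorem tensorId_unitaryChannel {n : ℕ} (U : Op (Fin n)) (ℓ : ℕ)
    (ρ : Matrix (Bits (Fin n) × Bits (Fin ℓ)) (Bits (Fin n) × Bits (Fin ℓ)) ℂ) :
    (unitaryChannel U).tensorId ℓ ρ
      = (U ⊗ₖ (1 : Op (Fin ℓ))) * ρ * (U ⊗ₖ (1 : Op (Fin ℓ)))ᴴ := by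
  ext ⟨x, z⟩ ⟨y, z'⟩
  simp [SuperOp.tensorId, unitaryChannel, Matrix.mul_apply, Fintype.sum_prod_type,
    Matrix.one_apply, apply_ite]

theorem tensorId_sum_smul {n : ℕ} {ι : Type} [Fintype ι] (p : ι → ℂ) (Φ : ι → SuperOp n) (ℓ : ℕ)
    (ρ : Matrix (Bits (Fin n) × Bits (Fin ℓ)) (Bits (Fin n) × Bits (Fin ℓ)) ℂ) :
    SuperOp.tensorId (∑ i, p i • Φ i) ℓ ρ = ∑ i, p i • (Φ i).tensorId ℓ ρ := by
  ext u v
  simp [SuperOp.tensorId, Matrix.sum_apply]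

theorem diamondDist_mixture_le {n : ℕ} {ι : Type} [Fintype ι] {p : ι → ℝ} (hp : ∀ i, 0 ≤ p i)
    (hp1 : ∑ i, p i = 1) {A : ι → Op (Fin n)} {U B : Op (Fin n)}
    (hA : ∀ i, (A i)ᴴ * A i = 1) (hU : Uᴴ * U = 1) (hB : Bᴴ * B = 1) {q : ℝ} (hq : 0 ≤ q)
    (hmix : ∑ i, (p i : ℂ) • A i = (1 - q : ℂ) • U + (q : ℂ) • B) :
    diamondDist (∑ i, (p i : ℂ) • unitaryChannel (A i)) (unitaryChannel U)
      ≤ ENNReal.ofReal (4 * q) := by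
  refine iSup_le fun ℓ => iSup_le fun ρ => iSup_le fun hρ => ENNReal.ofReal_le_ofReal ?_
  have hk : ∀ {V : Op (Fin n)}, Vᴴ * V = 1 →
      (V ⊗ₖ (1 : Op (Fin ℓ)))ᴴ * (V ⊗ₖ (1 : Op (Fin ℓ))) = 1 := fun {V} hV => by
    rw [Matrix.conjTranspose_kronecker, ← Matrix.mul_kronecker_mul, hV]
    simp
  rw [tensorId_sum_smul]
  simp only [tensorId_unitaryChannel]
  refine traceDist_mixture_le hp hp1 (fun i => hk (hA i)) (hk hU) (hk hB) hq ?_ hρ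
  ext ⟨x, z⟩ ⟨y, z'⟩
  have := congrArg (· * (1 : Op (Fin ℓ)) z z') (congrFun (congrFun hmix x) y)
  simpa [Matrix.sum_apply, Finset.sum_mul, add_mul, mul_assoc] using this

theorem diamondDist_self {n : ℕ} (Φ : SuperOp n) : diamondDist Φ Φ = 0 := by
  simp [diamondDist, traceDist, traceNorm]

/-- Diamond distance zero is tested on the maximally entangled state, whose image under
`Φ ⊗ I` lists the values of `Φ` on the matrix units. -/
theorem eq_of_diamondDist_eq_zero {n : ℕ} {Φ Ψ : SuperOp n} (h : diamondDist Φ Ψ = 0) :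
    Φ = Ψ := by
  set c : ℝ := (Fintype.card (Bits (Fin n)) : ℝ)⁻¹ with hc
  have hc0 : 0 < c := by rw [hc]; positivity
  set ψ : Bits (Fin n) × Bits (Fin n) → ℂ := fun u => if u.1 = u.2 then 1 else 0 with hψ
  set ρ := (c : ℂ) • Matrix.vecMulVec ψ (star ψ) with hρdef
  have hρ : IsDensity ρ := by
    refine ⟨(Matrix.posSemidef_vecMulVec_self_star ψ).smul (by exact_mod_cast hc0.le), ?_⟩
    simp [hρdef, Matrix.trace, Matrix.vecMulVec_apply, hψ,
      Fintype.sum_prod_type, hc]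
  have hle : ENNReal.ofReal (traceDist (Φ.tensorId n ρ) (Ψ.tensorId n ρ)) ≤ 0 := by
    rw [← h]
    exact le_iSup_of_le n (le_iSup_of_le ρ (le_iSup_of_le hρ le_rfl))
  have h0 : ∀ {M : Matrix (Bits (Fin n) × Bits (Fin n)) (Bits (Fin n) × Bits (Fin n)) ℂ},
      0 ≤ traceNorm M := fun {M} => by
    have hp := Matrix.posSemidef_conjTranspose_mul_self M
    rw [traceNorm, trace_cfc hp.1, ← Complex.ofReal_sum, Complex.ofReal_re]
    exact Finset.sum_nonneg fun i _ => Real.sqrt_nonneg _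
  have hz : Φ.tensorId n ρ - Ψ.tensorId n ρ = 0 := by
    apply eq_zero_of_traceNorm_eq_zero
    have h1 := ENNReal.ofReal_eq_zero.1 (le_antisymm hle bot_le)
    rw [traceDist] at h1
    linarith [h0 (M := Φ.tensorId n ρ - Ψ.tensorId n ρ)]
  have hblock : ∀ y y' : Bits (Fin n),
      (Matrix.of fun x x' => ρ (x, y) (x', y') : Op (Fin n)) = (c : ℂ) • Matrix.single y y' 1 := by
    intro y y'
    ext x x'
    simp [hρdef, hψ, Matrix.vecMulVec_apply, Matrix.single_apply, eq_comm, ← ite_and,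
      and_comm]
  have hsingle : ∀ y y' : Bits (Fin n),
      Φ (Matrix.single y y' 1) = Ψ (Matrix.single y y' 1) := by
    intro y y'
    ext x x'
    have h2 := congrFun (congrFun (sub_eq_zero.1 hz) (x, y)) (x', y')
    simp only [SuperOp.tensorId, Matrix.of_apply, hblock, map_smul, Matrix.smul_apply,
      smul_eq_mul] at h2
    exact mul_left_cancel₀ (by exact_mod_cast hc0.ne') h2
  refine LinearMap.ext fun M => ?_
  rw [Matrix.matrix_eq_sum_single M]
  simp only [map_sum]
  refine Finset.sum_congr rfl fun y _ => Finset.sum_congr rfl fun y' _ => ?_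
  have hs : Matrix.single y y' (M y y') = M y y' • Matrix.single y y' (1 : ℂ) := by
    rw [Matrix.smul_single, smul_eq_mul, mul_one]
  rw [hs, map_smul, map_smul, hsingle]

/-! ### Monomial operators and elementary circuits -/

section Elementary

variable {Q : Type} [Fintype Q] [DecidableEq Q]

/-- The monomial operator sending `|v⟩` to `φ v |f v⟩`. -/
def phasedMap (φ : Bits Q → ℂ) (f : Bits Q → Bits Q) : Op Q :=
  Matrix.of fun w v => if w = f v then φ v else 0

theorem basisMap_eq_phasedMap (f : Bits Q → Bits Q) : basisMap f = phasedMap (fun _ => 1) f := rfl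

theorem phasedMap_mul (φ ψ : Bits Q → ℂ) (f g : Bits Q → Bits Q) :
    phasedMap φ f * phasedMap ψ g = phasedMap (fun v => φ (g v) * ψ v) fun v => f (g v) := by
  ext w v
  simp [phasedMap, Matrix.mul_apply]

theorem basisMap_mul (f g : Bits Q → Bits Q) :
    basisMap f * basisMap g = basisMap fun v => f (g v) := by
  simp [basisMap_eq_phasedMap, phasedMap_mul]

theorem basisMap_id : basisMap (fun v : Bits Q => v) = 1 := by
  ext w v
  simp [basisMap, Matrix.one_apply]

theorem basisMap_conjTranspose_mul_self {f : Bits Q → Bits Q} (hf : f.Injective) :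
    (basisMap f)ᴴ * basisMap f = 1 := by
  ext w v
  simp [basisMap, Matrix.mul_apply, Matrix.one_apply, apply_ite, hf.eq_iff, eq_comm]

theorem Circuit.toOp_append (c d : Circuit Q) :
    Circuit.toOp (c ++ d) = Circuit.toOp d * Circuit.toOp c := by
  induction c with
  | nil => simp [Circuit.toOp]
  | cons g c ih => rw [List.cons_append, Circuit.toOp, Circuit.toOp, ih, mul_assoc]

theorem onQubit_phase (q : Q) (θ : ℝ) :
    onQubit q (phase θ)
      = phasedMap (fun v => if v q then Complex.exp (θ * Complex.I) else 1) fun v => v := by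
  ext w v
  simp only [onQubit, phase, phasedMap, Matrix.of_apply, Matrix.diagonal_apply]
  by_cases h : w = v
  · simp [h]
  · rw [if_neg h]
    split_ifs with h1 h2
    all_goals try rfl
    all_goals
      refine absurd (funext fun r => ?_) h
      by_cases hr : r = q
      · rw [hr, h2]
      · exact h1 r hr

theorem sum_ite_agree (q : Q) (v : Bits Q) (F : Bits Q → ℂ) :
    ∑ u, (if ∀ r, r ≠ q → u r = v r then F u else 0) = ∑ b, F (Function.update v q b) := by
  rw [← Finset.sum_filter]
  symm
  refine Finset.sum_nbij' (fun b => Function.update v q b) (fun u => u q) ?_ ?_ ?_ ?_ ?_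
  · intro b _
    simp +contextual [Function.update_of_ne]
  · simp
  · simp
  · intro u hu
    funext r
    by_cases hr : r = q
    · simp [hr]
    · rw [Function.update_of_ne hr]
      exact ((Finset.mem_filter.1 hu).2 r hr).symm
  · simp

/-- Conjugating a controlled sign by Hadamards on `t` gives a controlled NOT with target `t`,
whatever the control condition `g` on the other qubits. -/
theorem hadamard_conj_sign (t : Q) (g : Bits Q → Bool)
    (hg : ∀ v b, g (Function.update v t b) = g v) :
    onQubit t hadamard * phasedMap (fun v => if g v && v t then -1 else 1) (fun v => v)
        * onQubit t hadamard
      = basisMap fun v => Function.update v t (xor (v t) (g v)) := by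
  have h2 : ((Real.sqrt 2 : ℂ))⁻¹ * ((Real.sqrt 2 : ℂ))⁻¹ = 1 / 2 := by
    rw [← mul_inv, ← Complex.ofReal_mul, Real.mul_self_sqrt (by norm_num)]
    norm_num
  ext w v
  have hl : ∀ u, (onQubit t hadamard
      * phasedMap (fun v => if g v && v t then -1 else 1) (fun v => v)) w u
        = onQubit t hadamard w u * (if g u && u t then -1 else 1) := fun u => by
    simp [phasedMap, Matrix.mul_apply]
  rw [Matrix.mul_apply]
  simp only [hl]
  have hr : ∀ u, onQubit t hadamard u v
      = if ∀ r, r ≠ t → u r = v r then hadamard (u t) (v t) else 0 := fun u => rfl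
  have hr' : ∀ u, onQubit t hadamard w u * (if g u && u t then -1 else 1)
      * onQubit t hadamard u v = if ∀ r, r ≠ t → u r = v r then
        onQubit t hadamard w u * (if g u && u t then -1 else 1) * hadamard (u t) (v t) else 0 :=
    fun u => by rw [hr, mul_ite, mul_zero]
  simp only [hr']
  rw [sum_ite_agree t v fun u =>
    onQubit t hadamard w u * (if g u && u t then -1 else 1) * hadamard (u t) (v t)]
  simp only [hg, Function.update_self]
  have ho : ∀ b, onQubit t hadamard w (Function.update v t b)
      = if ∀ r, r ≠ t → w r = v r then hadamard (w t) b else 0 := fun b => by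
    simp only [onQubit, Matrix.of_apply, Function.update_self]
    congr 1
    exact propext (forall₂_congr fun r hr => by rw [Function.update_of_ne hr])
  simp only [ho]
  have hw : w = Function.update v t (xor (v t) (g v))
      ↔ (∀ r, r ≠ t → w r = v r) ∧ w t = xor (v t) (g v) := by
    rw [Function.eq_update_iff, and_comm]
  simp only [basisMap, Matrix.of_apply, hw]
  by_cases hag : ∀ r, r ≠ t → w r = v r
  · simp only [if_pos hag, and_iff_right hag, Fintype.sum_bool, hadamard, Matrix.of_apply]
    cases w t <;> cases v t <;> cases g v <;> simp <;> linear_combination (2 : ℂ) * h2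
  · simp [hag]

/-- The phase `e^{iπ/4}` of the gate `T`. -/
def omega8 : ℂ := Complex.exp ((Real.pi / 4 : ℝ) * Complex.I)

theorem omega8_sq : Complex.exp ((Real.pi / 2 : ℝ) * Complex.I) = omega8 ^ 2 := by
  rw [omega8, ← Complex.exp_nat_mul]
  congr 1
  push_cast
  ring

theorem omega8_pow_four : omega8 ^ 4 = -1 := by
  rw [omega8, ← Complex.exp_nat_mul, ← Complex.exp_pi_mul_I]
  congr 1
  push_cast
  ring

theorem toOp_T (q : Q) :
    (Gate.T q).toOp = phasedMap (fun v => if v q then omega8 else 1) fun v => v :=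
  onQubit_phase q _

theorem toOp_S (q : Q) :
    (Gate.S q).toOp = phasedMap (fun v => if v q then omega8 ^ 2 else 1) fun v => v := by
  rw [← omega8_sq]
  exact onQubit_phase q _

theorem toOp_CNOT (p q : Q) (h : p ≠ q) :
    (Gate.CNOT p q h).toOp
      = phasedMap (fun _ => 1) fun v => Function.update v q (xor (v q) (v p)) := rfl

/-- The NOT gate `H S² H`. -/
def notCircuit (t : Q) : Circuit Q := [.H t, .S t, .S t, .H t]

theorem toOp_notCircuit (t : Q) :
    (notCircuit t).toOp = basisMap fun v => Function.update v t (!v t) := by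
  have h := hadamard_conj_sign t (fun _ => true) fun _ _ => rfl
  simp only [Bool.xor_true] at h
  rw [← h]
  simp only [notCircuit, Circuit.toOp, one_mul, toOp_S]
  rw [mul_assoc (Gate.toOp _), phasedMap_mul]
  have hp : (fun v : Bits Q => (if v t then omega8 ^ 2 else 1) * if v t then omega8 ^ 2 else 1)
      = fun v => if true && v t then -1 else 1 := by
    funext v
    cases v t <;> simp [← pow_add, omega8_pow_four]
  rw [hp]
  rfl

/-- The doubly controlled sign gate as the phase polynomial
`4xyz = x + y + z - (x ⊕ y) - (y ⊕ z) - (x ⊕ z) + (x ⊕ y ⊕ z)` in powers of `e^{iπ/4}`, where the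
inverse of `T` is written `T S³`. -/
def cczCircuit (a b t : Q) (hab : a ≠ b) (hat : a ≠ t) (hbt : b ≠ t) : Circuit Q :=
  [.T a, .T b, .T t, .CNOT a b hab, .T b, .S b, .S b, .S b, .CNOT b t hbt, .T t, .CNOT a b hab,
    .CNOT b t hbt, .T t, .S t, .S t, .S t, .CNOT a t hat, .CNOT b t hbt, .T t, .S t, .S t, .S t,
    .CNOT b t hbt]

theorem toOp_cczCircuit (a b t : Q) (hab : a ≠ b) (hat : a ≠ t) (hbt : b ≠ t) :
    (cczCircuit a b t hab hat hbt).toOp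
      = phasedMap (fun v => if (v a && v b) && v t then -1 else 1) fun v => v := by
  have h8 : omega8 ^ 8 = 1 := by
    rw [show 8 = 4 * 2 from rfl, pow_mul, omega8_pow_four]; norm_num
  simp only [cczCircuit, Circuit.toOp, one_mul, toOp_S, toOp_T, toOp_CNOT, phasedMap_mul]
  congr 1
  · funext v
    simp only [Function.update_self, Function.update_of_ne hab, Function.update_of_ne hat,
      Function.update_of_ne hbt, Function.update_of_ne hbt.symm]
    cases v a <;> cases v b <;> cases v t <;> simp <;> ring_nf <;>
      simp [h8, omega8_pow_four, show omega8 ^ 16 = (omega8 ^ 8) ^ 2 by ring]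
  · funext v r
    by_cases hrt : r = t
    · subst hrt
      simp only [Function.update_self, Function.update_of_ne hab, Function.update_of_ne hat,
        Function.update_of_ne hbt, Function.update_of_ne hbt.symm]
      cases v a <;> cases v b <;> cases v r <;> rfl
    · by_cases hrb : r = b
      · subst hrb
        simp only [Function.update_self, Function.update_of_ne hab, Function.update_of_ne hat,
          Function.update_of_ne hbt, Function.update_of_ne hbt.symm]
        cases v a <;> cases v r <;> rfl
      · simp [Function.update_of_ne hrt, Function.update_of_ne hrb]

/-- The three-qubit Toffoli gate with controls `a`, `b` and target `t`. -/
def toffoliCircuit (a b t : Q) (hab : a ≠ b) (hat : a ≠ t) (hbt : b ≠ t) : Circuit Q :=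
  [.H t] ++ cczCircuit a b t hab hat hbt ++ [.H t]

theorem toOp_toffoliCircuit (a b t : Q) (hab : a ≠ b) (hat : a ≠ t) (hbt : b ≠ t) :
    (toffoliCircuit a b t hab hat hbt).toOp
      = basisMap fun v => Function.update v t (xor (v t) (v a && v b)) := by
  rw [← hadamard_conj_sign t (fun v => v a && v b) fun v c => by
    simp [Function.update_of_ne hat, Function.update_of_ne hbt]]
  rw [toffoliCircuit, Circuit.toOp_append, Circuit.toOp_append, toOp_cczCircuit, ← mul_assoc]
  simp [Circuit.toOp, Gate.toOp]

end Elementary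

/-! ### `T`-counts, and circuits on a part of a register -/

section Embedding

variable {Q R : Type}

theorem Circuit.tCount_append (c d : Circuit Q) :
    Circuit.tCount (c ++ d) = Circuit.tCount c + Circuit.tCount d := by
  induction c with
  | nil => simp [Circuit.tCount]
  | cons g c ih =>
    cases g
    all_goals
      simp only [List.cons_append, Circuit.tCount, ih]
      try omega

theorem tCount_notCircuit (t : Q) : (notCircuit t).tCount = 0 := rfl

theorem tCount_toffoliCircuit (a b t : Q) (hab : a ≠ b) (hat : a ≠ t) (hbt : b ≠ t) :
    (toffoliCircuit a b t hab hat hbt).tCount = 7 := rfl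

/-- Relabelling of the qubits of a gate. -/
def Gate.map (ι : Q ↪ R) : Gate Q → Gate R
  | .H q => .H (ι q)
  | .S q => .S (ι q)
  | .CNOT p q h => .CNOT (ι p) (ι q) (ι.injective.ne h)
  | .T q => .T (ι q)

theorem tCount_map (ι : Q ↪ R) (c : Circuit Q) :
    Circuit.tCount (c.map (Gate.map ι)) = c.tCount := by
  induction c with
  | nil => rfl
  | cons g c ih => cases g <;> simp [Gate.map, Circuit.tCount, ih]

variable [Fintype Q] [Fintype R] [DecidableEq R]

/-- The operator on the register `R` that acts as `M` on the qubits in the range of `ι` and as the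
identity on the others. -/
def embedOp (ι : Q ↪ R) (M : Op Q) : Op R :=
  Matrix.of fun w v =>
    if ∀ r, (∀ q, ι q ≠ r) → w r = v r then M (fun q => w (ι q)) (fun q => v (ι q)) else 0

theorem embedOp_one (ι : Q ↪ R) : embedOp ι 1 = 1 := by
  ext w v
  simp only [embedOp, Matrix.of_apply, Matrix.one_apply, ← ite_and]
  congr 1
  refine propext ⟨fun ⟨h1, h2⟩ => funext fun r => ?_, fun h => by simp [h]⟩
  by_cases hr : ∃ q, ι q = r
  · obtain ⟨q, rfl⟩ := hr
    exact congrFun h2 q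
  · exact h1 r (not_exists.1 hr)

theorem embedOp_mul [DecidableEq Q] (ι : Q ↪ R) (M N : Op Q) :
    embedOp ι M * embedOp ι N = embedOp ι (M * N) := by
  ext w v
  simp only [Matrix.mul_apply, embedOp, Matrix.of_apply, mul_ite, mul_zero]
  rw [← Finset.sum_filter]
  have hex : ∀ (b : Bits Q) (r : R), (∀ q, ι q ≠ r) → Function.extend ι b v r = v r :=
    fun b r hr => Function.extend_apply' _ _ _ fun ⟨q, hq⟩ => hr q hq
  have hbij : ∑ u : Bits R with ∀ r, (∀ q, ι q ≠ r) → u r = v r,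
      (if ∀ r, (∀ q, ι q ≠ r) → w r = u r then M (fun q => w (ι q)) (fun q => u (ι q)) else 0)
        * N (fun q => u (ι q)) (fun q => v (ι q))
      = ∑ b, (if ∀ r, (∀ q, ι q ≠ r) → w r = v r then M (fun q => w (ι q)) b else 0)
        * N b (fun q => v (ι q)) := by
    symm
    refine Finset.sum_nbij' (fun b => Function.extend ι b v) (fun u q => u (ι q)) ?_ ?_ ?_ ?_ ?_
    · intro b _
      simpa using hex b
    · simp
    · intro b _
      funext q
      exact ι.injective.extend_apply _ _ _
    · intro u hu
      funext r
      by_cases hr : ∃ q, ι q = r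
      · obtain ⟨q, rfl⟩ := hr
        exact ι.injective.extend_apply _ _ _
      · rw [hex _ _ (not_exists.1 hr)]
        exact ((Finset.mem_filter.1 hu).2 r (not_exists.1 hr)).symm
    · intro b _
      have h1 : (∀ r, (∀ q, ι q ≠ r) → w r = Function.extend ι b v r)
          ↔ ∀ r, (∀ q, ι q ≠ r) → w r = v r :=
        forall₂_congr fun r hr => by rw [hex b r hr]
      simp only [h1, ι.injective.extend_apply]
  rw [hbij]
  split_ifs <;> simp

theorem toOp_gate_map [DecidableEq Q] (ι : Q ↪ R) (g : Gate Q) :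
    (g.map ι).toOp = embedOp ι g.toOp := by
  have h1 : ∀ (q : Q) (M : Matrix Bool Bool ℂ), onQubit (ι q) M = embedOp ι (onQubit q M) := by
    intro q M
    ext w v
    simp only [onQubit, embedOp, Matrix.of_apply, ← ite_and]
    congr 1
    refine propext ⟨fun h => ⟨fun r hr => h r (hr q).symm,
      fun r hr => h _ (ι.injective.ne hr)⟩, fun ⟨h, h'⟩ r hr => ?_⟩
    by_cases hr' : ∃ p, ι p = r
    · obtain ⟨p, rfl⟩ := hr'
      exact h' p fun hp => hr (congrArg ι hp)
    · exact h r (not_exists.1 hr')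
  cases g with
  | H q => exact h1 q _
  | S q => exact h1 q _
  | T q => exact h1 q _
  | CNOT p t h =>
    ext w v
    simp only [Gate.map, Gate.toOp, basisMap, embedOp, Matrix.of_apply, ← ite_and]
    congr 1
    rw [Function.eq_update_iff, Function.eq_update_iff]
    refine propext ⟨fun ⟨ht, hr⟩ => ⟨fun r hr' => hr r (hr' t).symm, ht,
      fun r hr' => hr _ (ι.injective.ne hr')⟩, fun ⟨ho, ht, hr⟩ => ⟨ht, fun r hr' => ?_⟩⟩
    by_cases hrq : ∃ q, ι q = r
    · obtain ⟨q, rfl⟩ := hrq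
      exact hr q fun hq => hr' (congrArg ι hq)
    · exact ho r (not_exists.1 hrq)

theorem toOp_map [DecidableEq Q] (ι : Q ↪ R) (c : Circuit Q) :
    Circuit.toOp (c.map (Gate.map ι)) = embedOp ι c.toOp := by
  induction c with
  | nil => simp [Circuit.toOp, embedOp_one]
  | cons g c ih => rw [List.map_cons, Circuit.toOp, Circuit.toOp, ih, toOp_gate_map, embedOp_mul]

end Embedding

/-! ### Channels of circuits -/

section Channel

variable {n a : ℕ}

/-- The ancillas in the state `|0^a⟩`. -/
abbrev zeros (a : ℕ) : Bits (Fin a) := fun _ => false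

theorem channel_apply (c : Circuit (Fin n ⊕ Fin a)) (ρ : Op (Fin n)) (x x' : Bits (Fin n)) :
    c.channel ρ x x' = ∑ z, ∑ y', ∑ y, c.toOp (Sum.elim x z) (Sum.elim y (zeros a)) * ρ y y'
      * star (c.toOp (Sum.elim x' z) (Sum.elim y' (zeros a))) := by
  have hsum : ∀ F : Bits (Fin n ⊕ Fin a) → ℂ, (∀ y z, z ≠ zeros a → F (Sum.elim y z) = 0) →
      ∑ u, F u = ∑ y, F (Sum.elim y (zeros a)) := by
    intro F hF
    rw [← (Equiv.sumArrowEquivProdArrow (Fin n) (Fin a) Bool).symm.sum_comp F,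
      Fintype.sum_prod_type]
    exact Finset.sum_congr rfl fun y _ =>
      Fintype.sum_eq_single (zeros a) fun z hz => hF y z hz
  have hne : ∀ z : Bits (Fin a), z ≠ zeros a → ¬ ∀ j, z j = false := fun z hz h => hz (funext h)
  change ∑ z, (c.toOp * addAncillas a ρ * c.toOpᴴ) (Sum.elim x z) (Sum.elim x' z) = _
  refine Finset.sum_congr rfl fun z _ => ?_
  rw [Matrix.mul_apply, hsum]
  · refine Finset.sum_congr rfl fun y' _ => ?_
    rw [Matrix.mul_apply, hsum]
    · simp [addAncillas, Finset.sum_mul]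
    · intro y z hz
      simp [addAncillas, hne z hz]
  · intro y z hz
    simp [Matrix.mul_apply, addAncillas, hne z hz]

/-- The channel of a circuit is conjugation by `U` exactly when the two agree on matrix units. -/
theorem channel_eq_unitaryChannel_iff (c : Circuit (Fin n ⊕ Fin a)) (U : Op (Fin n)) :
    c.channel = unitaryChannel U ↔ ∀ x x' y y', ∑ z,
      c.toOp (Sum.elim x z) (Sum.elim y (zeros a))
        * star (c.toOp (Sum.elim x' z) (Sum.elim y' (zeros a))) = U x y * star (U x' y') := by
  constructor
  · intro h x x' y y'
    have h1 := congrFun (congrFun (LinearMap.congr_fun h (Matrix.single y y' 1)) x) x'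
    rw [channel_apply] at h1
    simpa [unitaryChannel, Matrix.mul_apply, Matrix.single_apply, ite_and, Finset.sum_mul] using h1
  · intro h
    refine LinearMap.ext fun ρ => ?_
    ext x x'
    rw [channel_apply, Finset.sum_comm]
    simp only [unitaryChannel, LinearMap.coe_mk, AddHom.coe_mk, Matrix.mul_apply,
      Matrix.conjTranspose_apply, Finset.sum_mul]
    refine Finset.sum_congr rfl fun y' _ => ?_
    rw [Finset.sum_comm]
    refine Finset.sum_congr rfl fun y _ => ?_
    rw [mul_right_comm, ← h x x' y y', Finset.sum_mul]
    exact Finset.sum_congr rfl fun z _ => by ring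

theorem sumElim_eq_iff {x x' : Bits (Fin n)} {z z' : Bits (Fin a)} :
    (Sum.elim x z : Bits (Fin n ⊕ Fin a)) = Sum.elim x' z' ↔ x = x' ∧ z = z' :=
  ⟨fun h => ⟨funext fun i => congrFun h (Sum.inl i), funext fun j => congrFun h (Sum.inr j)⟩,
    fun ⟨h, h'⟩ => by rw [h, h']⟩

/-- A reversible classical circuit that returns its ancillas to zero acts as a basis map. -/
theorem channel_eq_of_basisMap (c : Circuit (Fin n ⊕ Fin a))
    {F : Bits (Fin n ⊕ Fin a) → Bits (Fin n ⊕ Fin a)} {f : Bits (Fin n) → Bits (Fin n)}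
    (hc : c.toOp = basisMap F)
    (hF : ∀ x, F (Sum.elim x (zeros a)) = Sum.elim (f x) (zeros a)) :
    c.channel = unitaryChannel (basisMap f) := by
  rw [channel_eq_unitaryChannel_iff]
  intro x x' y y'
  simp only [hc, basisMap, hF, sumElim_eq_iff, Matrix.of_apply]
  split_ifs <;> simp_all

end Channel

/-! ### Exact Toffoli circuits with linear `T`-count -/

section Ladder

theorem toffoli_succ (r : ℕ) :
    toffoli (r + 1) = basisMap fun v => Function.update v (Fin.last r)
      (xor (v (Fin.last r)) (decide (∀ i : Fin r, v i.castSucc = true))) := by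
  rw [toffoli]
  congr 1
  funext v i
  have hd : (∀ j : Fin (r + 1), (j : ℕ) + 1 < r + 1 → v j = true)
      ↔ ∀ j : Fin r, v j.castSucc = true :=
    ⟨fun h j => h _ (by simp), fun h j hj => h ⟨j, by omega⟩⟩
  simp only [hd]
  by_cases hi : i = Fin.last r
  · subst hi
    simp
  · have hi' : (i : ℕ) + 1 ≠ r + 1 := fun h => hi (Fin.ext (by simpa using h))
    rw [Function.update_of_ne hi, if_neg hi']

/-- The step of the ladder that multiplies the `i`-th input into the partial conjunction held in
ancilla `i` and stores the product in ancilla `i + 1`. -/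
def ladderStep (r i : ℕ) : Circuit (Fin (r + 1) ⊕ Fin (r + 1)) :=
  if h : i < r then
    toffoliCircuit (.inl ⟨i, by omega⟩) (.inr ⟨i, by omega⟩) (.inr ⟨i + 1, by omega⟩)
      (by simp) (by simp) (by simp)
  else []

/-- The circuit that writes the conjunctions of the first `0, …, i` inputs into the ancillas. -/
def ladder (r : ℕ) : ℕ → Circuit (Fin (r + 1) ⊕ Fin (r + 1))
  | 0 => notCircuit (.inr 0)
  | i + 1 => ladder r i ++ ladderStep r i

/-- The inverse of `ladder`: the same steps in the opposite order. -/
def unladder (r : ℕ) : ℕ → Circuit (Fin (r + 1) ⊕ Fin (r + 1))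
  | 0 => notCircuit (.inr 0)
  | i + 1 => ladderStep r i ++ unladder r i

theorem tCount_ladderStep_le (r i : ℕ) : (ladderStep r i).tCount ≤ 7 := by
  rw [ladderStep]
  split_ifs
  · rw [tCount_toffoliCircuit]
  · simp [Circuit.tCount]

theorem tCount_ladder_le (r i : ℕ) : (ladder r i).tCount ≤ 7 * i := by
  induction i with
  | zero => rw [ladder, tCount_notCircuit]
  | succ i ih =>
    rw [ladder, Circuit.tCount_append]
    have := tCount_ladderStep_le r i
    omega

theorem tCount_unladder_le (r i : ℕ) : (unladder r i).tCount ≤ 7 * i := by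
  induction i with
  | zero => rw [unladder, tCount_notCircuit]
  | succ i ih =>
    rw [unladder, Circuit.tCount_append]
    have := tCount_ladderStep_le r i
    omega

/-- The partial conjunctions `x₀ ∧ ⋯ ∧ x_{j-1}` for `j ≤ i`, with `false` in the later places. -/
def conjunctions {r : ℕ} (i : ℕ) (x : Bits (Fin (r + 1))) : Bits (Fin (r + 1)) :=
  fun j => decide ((j : ℕ) ≤ i ∧ ∀ l : Fin (r + 1), l < j → x l = true)

theorem exists_basisMap_ladder (r i : ℕ) (hi : i ≤ r) :
    ∃ F G : Bits (Fin (r + 1) ⊕ Fin (r + 1)) → Bits (Fin (r + 1) ⊕ Fin (r + 1)),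
      (ladder r i).toOp = basisMap F ∧ (unladder r i).toOp = basisMap G ∧ (∀ v, G (F v) = v) ∧
        ∀ x, F (Sum.elim x (zeros _)) = Sum.elim x (conjunctions i x) := by
  induction i with
  | zero =>
    refine ⟨_, _, toOp_notCircuit _, toOp_notCircuit _, fun v => by simp, fun x => ?_⟩
    funext q
    rcases q with l | j
    · simp
    · by_cases hj : j = 0
      · subst hj
        simp [conjunctions]
      · have hj' : (j : ℕ) ≠ 0 := fun h => hj (Fin.ext h)
        simp [Function.update_of_ne, hj, conjunctions]
  | succ i ih =>
    obtain ⟨F, G, hF, hG, hGF, hx⟩ := ih (by omega)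
    have hi' : i < r := by omega
    obtain ⟨t, ht⟩ : ∃ t : Bits (Fin (r + 1) ⊕ Fin (r + 1)) → Bits (Fin (r + 1) ⊕ Fin (r + 1)),
        t = fun u => Function.update u (.inr ⟨i + 1, by omega⟩) (xor (u (.inr ⟨i + 1, by omega⟩))
          (u (.inl ⟨i, by omega⟩) && u (.inr ⟨i, by omega⟩))) := ⟨_, rfl⟩
    have hstep : (ladderStep r i).toOp = basisMap t := by
      rw [ladderStep, dif_pos hi', toOp_toffoliCircuit, ht]
    have htt : ∀ u, t (t u) = u := fun u => by
      simp [ht]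
    refine ⟨fun v => t (F v), fun v => G (t v), ?_, ?_, fun v => ?_, fun x => ?_⟩
    · rw [ladder, Circuit.toOp_append, hF, hstep, basisMap_mul]
    · rw [unladder, Circuit.toOp_append, hG, hstep, basisMap_mul]
    · simp only [htt, hGF]
    · simp only [hx, ht]
      funext q
      rcases q with l | j
      · simp
      · by_cases hj : (j : ℕ) = i + 1
        · obtain rfl : j = ⟨i + 1, Nat.succ_lt_succ hi'⟩ := Fin.ext hj
          have hsplit : (∀ l : Fin (r + 1), l < ⟨i + 1, by omega⟩ → x l = true)
              ↔ x ⟨i, by omega⟩ = true ∧ ∀ l : Fin (r + 1), l < ⟨i, by omega⟩ → x l = true := by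
            constructor
            · exact fun h => ⟨h _ (by simp), fun l hl => h l (hl.trans (by simp))⟩
            · rintro ⟨h0, h⟩ l hl
              rcases (Nat.lt_succ_iff_lt_or_eq.1 (Fin.lt_def.1 hl)) with hl' | hl'
              · exact h l hl'
              · exact (congrArg x (Fin.ext hl')).trans h0
          simp [conjunctions, hsplit]
        · rw [Function.update_of_ne (by simpa [Fin.ext_iff] using hj)]
          have : (j : ℕ) ≤ i + 1 ↔ (j : ℕ) ≤ i := by omega
          simp [conjunctions, this]

/-- The `(r + 1)`-qubit Toffoli gate: compute the partial conjunctions in ancillas, copy the last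
of them onto the target, and uncompute. -/
theorem exists_circuit_toffoli (r : ℕ) :
    ∃ c : Circuit (Fin (r + 1) ⊕ Fin (r + 1)),
      c.channel = unitaryChannel (toffoli (r + 1)) ∧ c.tCount ≤ 14 * r := by
  obtain ⟨F, G, hF, hG, hGF, hx⟩ := exists_basisMap_ladder r r le_rfl
  refine ⟨ladder r r ++ [.CNOT (.inr (Fin.last r)) (.inl (Fin.last r)) (by simp)]
    ++ unladder r r, ?_, ?_⟩
  · rw [toffoli_succ]
    refine channel_eq_of_basisMap _ (F := fun v => G ((fun u => Function.update u
      (.inl (Fin.last r)) (xor (u (.inl (Fin.last r))) (u (.inr (Fin.last r))))) (F v))) ?_ ?_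
    · rw [Circuit.toOp_append, Circuit.toOp_append, hF, hG]
      simp only [Circuit.toOp, one_mul, Gate.toOp, basisMap_mul]
    · intro x
      set y := Function.update x (Fin.last r)
        (xor (x (Fin.last r)) (decide (∀ i : Fin r, x i.castSucc = true))) with hy
      -- The partial conjunctions do not involve the target, so flipping it leaves them valid.
      have hconj : conjunctions r x = conjunctions r y := by
        funext j
        have : (∀ l : Fin (r + 1), l < j → x l = true) ↔ ∀ l : Fin (r + 1), l < j → y l = true :=
          forall₂_congr fun l hl => by
            rw [hy, Function.update_of_ne (hl.trans_le (Fin.le_last j)).ne]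
        simp [conjunctions, this]
      have hlast : conjunctions r x (Fin.last r)
          = decide (∀ i : Fin r, x i.castSucc = true) := by
        have : (∀ l : Fin (r + 1), l < Fin.last r → x l = true)
            ↔ ∀ i : Fin r, x i.castSucc = true :=
          ⟨fun h i => h _ (Fin.castSucc_lt_last i), fun h l hl => h ⟨l, hl⟩⟩
        simp [conjunctions, this]
      have hstep : Function.update (Sum.elim x (conjunctions r x)) (.inl (Fin.last r))
          (xor (x (Fin.last r)) (conjunctions r x (Fin.last r))) = F (Sum.elim y (zeros _)) := by
        rw [hx, ← hconj, hlast, hy]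
        exact Sum.update_elim_inl
      simp only [hx, Sum.elim_inl, Sum.elim_inr]
      rw [hstep, hGF]
  · have h1 := tCount_ladder_le r r
    have h2 := tCount_unladder_le r r
    simp only [Circuit.tCount_append, Circuit.tCount]
    omega

theorem unitaryTCount_le {n a : ℕ} {U : Op (Fin n)} (c : Circuit (Fin n ⊕ Fin a))
    (hc : c.channel = unitaryChannel U) : unitaryTCount 0 U ≤ c.tCount := by
  refine iInf_le_of_le a (iInf_le_of_le c (iInf_le_of_le ?_ le_rfl))
  rw [hc, diamondDist_self]
  exact bot_le

theorem unitaryTCount_toffoli_le (k : ℕ) :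
    unitaryTCount 0 (toffoli k) ≤ ((14 * (k - 1) : ℕ) : ℕ∞) := by
  rcases k with _ | r
  · have h : Circuit.channel ([] : Circuit (Fin 0 ⊕ Fin 0)) = unitaryChannel (toffoli 0) :=
      channel_eq_of_basisMap _ (F := fun v => v) basisMap_id.symm fun x => by
        funext q
        rcases q with q | q <;> exact q.elim0
    exact (unitaryTCount_le _ h).trans le_rfl
  · obtain ⟨c, hc, ht⟩ := exists_circuit_toffoli r
    exact (unitaryTCount_le c hc).trans (by exact_mod_cast ht)

end Ladder

/-! ### Toffoli gates conjugated by a computation of control bits -/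

section Controls

/-- The map `|x, z⟩ ↦ |x, z ⊕ g x⟩`. -/
def xorMap {n a : ℕ} (g : Bits (Fin n) → Bits (Fin a)) (v : Bits (Fin n ⊕ Fin a)) :
    Bits (Fin n ⊕ Fin a) :=
  Sum.elim (fun i => v (.inl i)) fun z => xor (v (.inr z)) (g (fun i => v (.inl i)) z)

theorem xorMap_elim {n a : ℕ} (g : Bits (Fin n) → Bits (Fin a)) (x : Bits (Fin n))
    (z : Bits (Fin a)) : xorMap g (Sum.elim x z) = Sum.elim x fun j => xor (z j) (g x j) := rfl

theorem xorMap_self {n a : ℕ} (g : Bits (Fin n) → Bits (Fin a)) (v : Bits (Fin n ⊕ Fin a)) :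
    xorMap g (xorMap g v) = v := by
  funext q
  rcases q with q | q <;> simp [xorMap]

theorem basisMap_conj_apply {Q : Type} [Fintype Q] [DecidableEq Q] {f : Bits Q → Bits Q}
    (hf : ∀ v, f (f v) = v) (M : Op Q) (w v : Bits Q) :
    (basisMap f * (M * basisMap f)) w v = M (f w) (f v) := by
  have h : ∀ u, w = f u ↔ u = f w := fun u =>
    ⟨fun h => by rw [h, hf], fun h => by rw [h, hf]⟩
  simp [Matrix.mul_apply, basisMap, h]

/-- The bits of a register of `m` controls followed by a target. -/
abbrev withTarget {m : ℕ} (p : Bits (Fin m)) (b : Bool) : Bits (Fin (m + 1)) :=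
  Fin.snoc (α := fun _ => Bool) p b

/-- The placement of a circuit on `m + 1` qubits and `a` ancillas: its controls become the first
`m` ancillas, its target the last qubit of the main register. -/
def placement (N m a : ℕ) : Fin (m + 1) ⊕ Fin a ↪ Fin (N + 1) ⊕ Fin (m + a) where
  toFun := Sum.elim
    (Fin.lastCases (motive := fun _ => Fin (N + 1) ⊕ Fin (m + a)) (.inl (Fin.last N))
      fun j => .inr (Fin.castAdd a j))
    fun z => .inr (Fin.natAdd m z)
  inj' := by
    rintro (i | z) (i' | z') h
    · induction i using Fin.lastCases <;> induction i' using Fin.lastCases <;> simp_all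
    · induction i using Fin.lastCases with
      | last => simp at h
      | cast i =>
        simp [Fin.ext_iff] at h
        omega
    · induction i' using Fin.lastCases with
      | last => simp at h
      | cast i =>
        simp [Fin.ext_iff] at h
        omega
    · simpa using h

@[simp]
theorem placement_last {N m a : ℕ} : placement N m a (.inl (Fin.last m)) = .inl (Fin.last N) := by
  change Fin.lastCases (motive := fun _ => Fin (N + 1) ⊕ Fin (m + a)) _ _ (Fin.last m) = _
  rw [Fin.lastCases_last]

@[simp]
theorem placement_castSucc {N m a : ℕ} (j : Fin m) :
    placement N m a (.inl j.castSucc) = .inr (Fin.castAdd a j) := by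
  change Fin.lastCases (motive := fun _ => Fin (N + 1) ⊕ Fin (m + a)) _ _ j.castSucc = _
  rw [Fin.lastCases_castSucc]

@[simp]
theorem placement_inr {N m a : ℕ} (z : Fin a) :
    placement N m a (.inr z) = .inr (Fin.natAdd m z) := rfl

theorem comp_placement {N m a : ℕ} (x : Bits (Fin (N + 1))) (p : Bits (Fin m)) (z : Bits (Fin a)) :
    (fun q => (Sum.elim x (Fin.append p z) : Bits (Fin (N + 1) ⊕ Fin (m + a)))
      (placement N m a q)) = Sum.elim (withTarget p (x (Fin.last N))) z := by
  funext q
  rcases q with i | z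
  · induction i using Fin.lastCases <;> simp [withTarget]
  · simp

theorem embedOp_placement_apply {N m a : ℕ} (M : Op (Fin (m + 1) ⊕ Fin a))
    (x y : Bits (Fin (N + 1))) (p p' : Bits (Fin m)) (z z' : Bits (Fin a)) :
    embedOp (placement N m a) M (Sum.elim x (Fin.append p z)) (Sum.elim y (Fin.append p' z'))
      = if ∀ i : Fin N, x i.castSucc = y i.castSucc then
          M (Sum.elim (withTarget p (x (Fin.last N))) z)
            (Sum.elim (withTarget p' (y (Fin.last N))) z')
        else 0 := by
  simp only [embedOp, Matrix.of_apply, comp_placement]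
  congr 1
  refine propext ⟨fun h i => h (.inl i.castSucc) ?_, fun h r hr => ?_⟩
  · rintro (j | j)
    · induction j using Fin.lastCases with
      | last => simpa using (Fin.castSucc_lt_last i).ne'
      | cast j => simp
    · simp
  · rcases r with i | j
    · induction i using Fin.lastCases with
      | last => exact absurd (by simp) (hr (.inl (Fin.last m)))
      | cast i => exact h i
    · induction j using Fin.addCases with
      | left j => exact absurd (by simp) (hr (.inl j.castSucc))
      | right j => exact absurd (by simp) (hr (.inr j))

theorem toffoli_withTarget_apply {m : ℕ} (p p' : Bits (Fin m)) (b b' : Bool) :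
    toffoli (m + 1) (withTarget p b) (withTarget p' b')
      = if p = p' ∧ b = xor b' (decide (∀ j, p' j = true)) then 1 else 0 := by
  rw [toffoli_succ]
  simp only [basisMap, Matrix.of_apply, withTarget, Fin.snoc_last, Fin.snoc_castSucc,
    Fin.update_snoc_last]
  congr 1
  rw [Fin.snoc_inj]

/-- Flipping the target when all control bits computed from the other qubits are set. -/
def controlledFlip {N m : ℕ} (h : Bits (Fin N) → Bits (Fin m)) (v : Bits (Fin (N + 1))) :
    Bits (Fin (N + 1)) :=
  Function.update v (Fin.last N)
    (xor (v (Fin.last N)) (decide (∀ j, h (fun i => v i.castSucc) j = true)))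

theorem basisMap_controlledFlip_apply {N m : ℕ} (h : Bits (Fin N) → Bits (Fin m))
    (x y : Bits (Fin (N + 1))) :
    basisMap (controlledFlip h) x y
      = if (∀ i : Fin N, x i.castSucc = y i.castSucc) ∧ x (Fin.last N)
          = xor (y (Fin.last N)) (decide (∀ j, h (fun i => y i.castSucc) j = true))
        then 1 else 0 := by
  simp only [basisMap, controlledFlip, Matrix.of_apply]
  congr 1
  rw [Function.eq_update_iff]
  refine propext ⟨fun ⟨h1, h2⟩ => ⟨fun i => h2 _ (Fin.castSucc_lt_last i).ne, h1⟩,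
    fun ⟨h1, h2⟩ => ⟨h2, fun i hi => ?_⟩⟩
  induction i using Fin.lastCases with
  | last => exact absurd rfl hi
  | cast i => exact h1 i

/-- Computing control bits `h x` into fresh ancillas, applying a Toffoli gate controlled by them,
and uncomputing them implements the flip of the target controlled by `h x`. The Toffoli circuit
`c` need only have the right channel: its own ancillas may end in any state. -/
theorem channel_conj_toffoli {N m a : ℕ} {h : Bits (Fin N) → Bits (Fin m)}
    {W : Circuit (Fin (N + 1) ⊕ Fin (m + a))}
    (hW : W.toOp = basisMap (xorMap fun x => Fin.append (h fun i => x i.castSucc) (zeros a)))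
    {c : Circuit (Fin (m + 1) ⊕ Fin a)} (hc : c.channel = unitaryChannel (toffoli (m + 1))) :
    Circuit.channel (W ++ c.map (Gate.map (placement N m a)) ++ W)
      = unitaryChannel (basisMap (controlledFlip h)) := by
  rw [channel_eq_unitaryChannel_iff] at hc ⊢
  intro x x' y y'
  have hz : zeros (m + a) = Fin.append (zeros m) (zeros a) := by
    funext j
    induction j using Fin.addCases <;> simp
  have happ : ∀ (p p' : Bits (Fin m)) (z : Bits (Fin a)),
      (fun j => xor (Fin.append p z j) (Fin.append p' (zeros a) j))
        = Fin.append (fun j => xor (p j) (p' j)) z := by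
    intro p p' z
    funext j
    induction j using Fin.addCases <;> simp
  have hentry : ∀ (x y : Bits (Fin (N + 1))) (p : Bits (Fin m)) (z : Bits (Fin a)),
      Circuit.toOp (W ++ c.map (Gate.map (placement N m a)) ++ W)
        (Sum.elim x (Fin.append p z)) (Sum.elim y (zeros (m + a)))
      = if ∀ i : Fin N, x i.castSucc = y i.castSucc then
          c.toOp (Sum.elim (withTarget (fun j => xor (p j) (h (fun i => x i.castSucc) j))
              (x (Fin.last N))) z)
            (Sum.elim (withTarget (h fun i => y i.castSucc) (y (Fin.last N))) (zeros a))
        else 0 := by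
    intro x y p z
    rw [Circuit.toOp_append, Circuit.toOp_append, hW, toOp_map,
      basisMap_conj_apply (xorMap_self _), hz, xorMap_elim, xorMap_elim, happ, happ,
      embedOp_placement_apply]
    simp only [Bool.false_xor]
  rw [← (Fin.appendEquiv m a).sum_comp, Fintype.sum_prod_type]
  simp only [Fin.appendEquiv, Equiv.coe_fn_mk, hentry, basisMap_controlledFlip_apply]
  by_cases hx : ∀ i : Fin N, x i.castSucc = y i.castSucc
  swap
  · simp [hx]
  by_cases hx' : ∀ i : Fin N, x' i.castSucc = y' i.castSucc
  swap
  · simp [hx']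
  have hxor : ∀ p p' : Bits (Fin m), (fun j => xor (p j) (p' j)) = p' ↔ p = zeros m := by
    intro p p'
    rw [funext_iff, funext_iff]
    exact forall_congr' fun j => by cases p j <;> cases p' j <;> simp
  simp only [if_pos hx, if_pos hx', hc, toffoli_withTarget_apply, funext hx, funext hx', hxor,
    and_iff_right hx, and_iff_right hx']
  rw [Fintype.sum_eq_single (zeros m) fun p hp => by simp [hp]]
  simp

end Controls

/-! ### Random parity checks -/

section Parity

/-- Whether the number of `i` in the list `L` with `s i` true and `x i` false is even. -/
def evenParity {ι : Type} (s x : ι → Bool) (L : List ι) : Bool :=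
  L.foldr (fun i b => xor (s i && !x i) b) true

/-- The check passed by `x` when `x` has an even number of zeros on the set `s`. -/
def check {N : ℕ} (s x : Bits (Fin N)) : Bool := evenParity s x (List.finRange N)

theorem sign_evenParity {ι : Type} (s x : ι → Bool) (L : List ι) :
    (if evenParity s x L then (1 : ℝ) else -1)
      = (L.map fun i => if s i && !x i then (-1 : ℝ) else 1).prod := by
  induction L with
  | nil => simp [evenParity]
  | cons i L ih =>
    rw [List.map_cons, List.prod_cons, ← ih, evenParity, List.foldr_cons]
    change (if xor (s i && !x i) (evenParity s x L) = true then (1 : ℝ) else -1) = _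
    cases s i && !x i <;> cases evenParity s x L <;> simp

theorem sign_check {N : ℕ} (s x : Bits (Fin N)) :
    (if check s x then (1 : ℝ) else -1) = ∏ i, if s i && !x i then (-1 : ℝ) else 1 := by
  rw [check, sign_evenParity, Fin.prod_univ_def]

theorem check_of_forall {N : ℕ} (s : Bits (Fin N)) {x : Bits (Fin N)} (hx : ∀ i, x i = true) :
    check s x = true := by
  have h := sign_check s x
  by_contra hc
  simp only [hx, hc, Bool.not_true, Bool.and_false, Bool.false_eq_true, if_false,
    Finset.prod_const_one] at h
  norm_num at h

/-- If `x` has a zero, half of all parity checks accept it: the signs of the checks sum to a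
product over the coordinates, whose factor at that zero vanishes. -/
theorem sum_check {N : ℕ} {x : Bits (Fin N)} (hx : ¬ ∀ i, x i = true) :
    ∑ s : Bits (Fin N), (if check s x then (1 : ℝ) else 0)
      = (Fintype.card (Bits (Fin N)) : ℝ) / 2 := by
  have hind : ∀ s, (if check s x then (1 : ℝ) else 0)
      = (1 + ∏ i, if s i && !x i then (-1 : ℝ) else 1) / 2 := fun s => by
    rw [← sign_check]
    split_ifs <;> norm_num
  have hzero : ∑ s : Bits (Fin N), ∏ i, (if s i && !x i then (-1 : ℝ) else 1) = 0 := by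
    have h := Finset.prod_univ_sum (fun _ : Fin N => (Finset.univ : Finset Bool))
      fun i b => if b && !x i then (-1 : ℝ) else 1
    rw [Fintype.piFinset_univ] at h
    rw [← h]
    obtain ⟨i, hi⟩ := not_forall.1 hx
    exact Finset.prod_eq_zero (Finset.mem_univ i) (by simp [Bool.eq_false_iff.2 hi])
  simp only [hind, ← Finset.sum_div, Finset.sum_add_distrib, hzero, add_zero, Finset.sum_const,
    Finset.card_univ, nsmul_eq_mul, mul_one]

theorem sum_forall_check {N m : ℕ} {x : Bits (Fin N)} (hx : ¬ ∀ i, x i = true) :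
    ∑ S : Fin m → Bits (Fin N), (if ∀ j, check (S j) x = true then (1 : ℝ) else 0)
      = (Fintype.card (Fin m → Bits (Fin N)) : ℝ) * (1 / 2) ^ m := by
  have h := Finset.prod_univ_sum (fun _ : Fin m => (Finset.univ : Finset (Bits (Fin N))))
    fun _ s => if check s x then (1 : ℝ) else 0
  rw [Fintype.piFinset_univ] at h
  have hprod : ∀ S : Fin m → Bits (Fin N), (if ∀ j, check (S j) x = true then (1 : ℝ) else 0)
      = ∏ j, if check (S j) x then (1 : ℝ) else 0 := fun S => by
    simp [Finset.prod_ite_zero]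
  simp only [hprod]
  have hcard : (Fintype.card (Fin m → Bits (Fin N)) : ℝ)
      = (Fintype.card (Bits (Fin N)) : ℝ) ^ m := by
    rw [Fintype.card_fun (α := Fin m), Fintype.card_fin, Nat.cast_pow]
  rw [← h, Finset.prod_const, sum_check hx, Finset.card_univ, Fintype.card_fin, hcard, ← mul_pow]
  congr 1
  ring

/-- The circuit that adds to ancilla `z` the parity check of the inputs in `L` selected by `s`. -/
def checkCircuit {N a : ℕ} (s : Bits (Fin N)) (z : Fin a) :
    List (Fin N) → Circuit (Fin (N + 1) ⊕ Fin a)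
  | [] => notCircuit (.inr z)
  | i :: L => checkCircuit s z L ++
      if s i then [.CNOT (.inl i.castSucc) (.inr z) (by simp)] ++ notCircuit (.inr z) else []

theorem tCount_checkCircuit {N a : ℕ} (s : Bits (Fin N)) (z : Fin a) (L : List (Fin N)) :
    (checkCircuit s z L).tCount = 0 := by
  induction L with
  | nil => exact tCount_notCircuit _
  | cons i L ih =>
    rw [checkCircuit, Circuit.tCount_append, ih]
    split_ifs <;> rfl

theorem toOp_checkCircuit {N a : ℕ} (s : Bits (Fin N)) (z : Fin a) (L : List (Fin N)) :
    (checkCircuit s z L).toOp = basisMap fun v => Function.update v (.inr z)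
      (xor (v (.inr z)) (evenParity s (fun i => v (.inl i.castSucc)) L)) := by
  induction L with
  | nil => simp [checkCircuit, toOp_notCircuit, evenParity]
  | cons i L ih =>
    have hcons : ∀ x : Bits (Fin N),
        evenParity s x (i :: L) = xor (s i && !x i) (evenParity s x L) := fun x => rfl
    rw [checkCircuit, Circuit.toOp_append, ih]
    split_ifs with hs
    · rw [Circuit.toOp_append, toOp_notCircuit]
      simp only [Circuit.toOp, one_mul, Gate.toOp, basisMap_mul, hcons, hs]
      congr 1
      funext v
      simp only [Function.update_self, Function.update_idem, Function.update_of_ne, ne_eq,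
        reduceCtorEq, not_false_eq_true]
      congr 1
      cases v (.inr z) <;> cases v (.inl i.castSucc) <;>
        cases evenParity s (fun i => v (.inl i.castSucc)) L <;> rfl
    · simp [Circuit.toOp, hcons, hs]

/-- The circuit that adds the checks `S j`, for `j` in a list, to the ancillas with index `j`. -/
def checksCircuit {N m : ℕ} (a : ℕ) (S : Fin m → Bits (Fin N)) :
    List (Fin m) → Circuit (Fin (N + 1) ⊕ Fin (m + a))
  | [] => []
  | j :: J => checksCircuit a S J ++ checkCircuit (S j) (Fin.castAdd a j) (List.finRange N)

theorem tCount_checksCircuit {N m : ℕ} (a : ℕ) (S : Fin m → Bits (Fin N)) (J : List (Fin m)) :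
    (checksCircuit a S J).tCount = 0 := by
  induction J with
  | nil => rfl
  | cons j J ih => rw [checksCircuit, Circuit.tCount_append, ih, tCount_checkCircuit]

theorem toOp_checksCircuit {N m : ℕ} (a : ℕ) (S : Fin m → Bits (Fin N)) {J : List (Fin m)}
    (hJ : J.Nodup) :
    (checksCircuit a S J).toOp = basisMap (xorMap fun x => Fin.append
      (fun j => decide (j ∈ J) && check (S j) fun i => x i.castSucc) (zeros a)) := by
  induction J with
  | nil =>
    rw [checksCircuit, Circuit.toOp, ← basisMap_id]
    congr 1
    funext v q
    rcases q with q | q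
    · rfl
    · induction q using Fin.addCases <;> simp [xorMap]
  | cons j J ih =>
    obtain ⟨hj, hJ⟩ := List.nodup_cons.1 hJ
    rw [checksCircuit, Circuit.toOp_append, ih hJ, toOp_checkCircuit, basisMap_mul]
    congr 1
    funext v q
    rcases q with q | q
    · simp [xorMap]
    · induction q using Fin.addCases with
      | left k =>
        by_cases hk : k = j
        · subst hk
          simp [xorMap, hj, check]
        · have : Fin.castAdd a k ≠ Fin.castAdd a j := fun h => hk (Fin.castAdd_injective _ _ h)
          simp [xorMap, hk]
      | right z =>
        have : Fin.natAdd m z ≠ Fin.castAdd a j := fun h => by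
          have := congrArg Fin.val h
          simp at this
          omega
        simp [xorMap, Function.update_of_ne, this]

theorem controlledFlip_injective {N m : ℕ} (h : Bits (Fin N) → Bits (Fin m)) :
    (controlledFlip h).Injective := by
  have hinv : ∀ v, controlledFlip h (controlledFlip h v) = v := fun v => by
    simp [controlledFlip, (Fin.castSucc_lt_last _).ne]
  exact Function.LeftInverse.injective hinv

theorem toffoli_eq_controlledFlip (N : ℕ) :
    toffoli (N + 1) = basisMap (controlledFlip fun x : Bits (Fin N) => x) :=
  toffoli_succ N

/-- The average over all `m`-tuples of parity checks of the flips they control is the Toffoli gate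
with weight `1 - 2⁻ᵐ`, plus the NOT gate on the target with weight `2⁻ᵐ`. The latter is written as a
flip controlled by no bits at all. -/
theorem average_controlledFlip (N m : ℕ) :
    ∑ S : Fin m → Bits (Fin N), (((Fintype.card (Fin m → Bits (Fin N)) : ℝ)⁻¹ : ℝ) : ℂ)
        • basisMap (controlledFlip fun x j => check (S j) x)
      = (1 - (((1 / 2) ^ m : ℝ) : ℂ)) • toffoli (N + 1)
        + (((1 / 2) ^ m : ℝ) : ℂ) • basisMap (controlledFlip fun _ => zeros 0) := by
  rw [toffoli_eq_controlledFlip]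
  set K : ℝ := (Fintype.card (Fin m → Bits (Fin N)) : ℝ) with hK
  have hK0 : K ≠ 0 := by rw [hK]; positivity
  have hK0' : (K : ℂ) ≠ 0 := by exact_mod_cast hK0
  ext w y
  simp only [Matrix.sum_apply, Matrix.add_apply, Matrix.smul_apply, smul_eq_mul]
  set x : Bits (Fin N) := fun i => y i.castSucc with hx
  by_cases hall : ∀ i, x i = true
  -- An all-one input passes every check, and there the Toffoli gate is the NOT gate.
  · have hall' : ∀ i : Fin N, y i.castSucc = true := hall
    have h1 : ∀ S : Fin m → Bits (Fin N),
        basisMap (controlledFlip fun x j => check (S j) x) w y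
          = basisMap (controlledFlip fun _ => zeros 0) w y := fun S => by
      simp [basisMap_controlledFlip_apply, ← hx, check_of_forall _ hall]
    have h2 : basisMap (controlledFlip fun x : Bits (Fin N) => x) w y
          = basisMap (controlledFlip fun _ => zeros 0) w y := by
      simp [basisMap_controlledFlip_apply, hall']
    simp only [h1, h2, Finset.sum_const, Finset.card_univ, nsmul_eq_mul]
    rw [← mul_assoc, ← Complex.ofReal_natCast, ← hK, ← Complex.ofReal_mul, mul_inv_cancel₀ hK0]
    push_cast
    ring
  -- On other inputs the Toffoli gate does nothing, and the flip occurs when all checks pass.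
  · have hall' : ¬ ∀ i : Fin N, y i.castSucc = true := hall
    have h1 : ∀ S : Fin m → Bits (Fin N),
        basisMap (controlledFlip fun x j => check (S j) x) w y
          = basisMap (controlledFlip fun x : Bits (Fin N) => x) w y
            + ((if ∀ j, check (S j) x = true then (1 : ℝ) else 0 : ℝ) : ℂ)
              * (basisMap (controlledFlip fun _ => zeros 0) w y
                - basisMap (controlledFlip fun x : Bits (Fin N) => x) w y) := fun S => by
      by_cases hc : ∀ j, check (S j) x = true <;>
        simp [basisMap_controlledFlip_apply, ← hx, hc, hall']
    simp only [h1, ← Finset.mul_sum, Finset.sum_add_distrib, ← Finset.sum_mul,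
      ← Complex.ofReal_sum, sum_forall_check hall, Finset.sum_const, Finset.card_univ,
      nsmul_eq_mul]
    rw [← Complex.ofReal_natCast, ← hK]
    push_cast
    field_simp
    ring

end Parity

/-! ### Mixed circuits -/

theorem mixedTCount_le {n a k : ℕ} {ε : ℝ} {U : Op (Fin n)} {Ω : Type} [Fintype Ω] {p : Ω → ℝ}
    (hp : ∀ S, 0 ≤ p S) (hp1 : ∑ S, p S = 1) (c : Ω → Circuit (Fin n ⊕ Fin a))
    (hk : ∀ S, (c S).tCount ≤ k)
    (hε : diamondDist (∑ S, (p S : ℂ) • (c S).channel) (unitaryChannel U) ≤ ENNReal.ofReal ε) :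
    mixedTCount ε U ≤ k := by
  set e := Fintype.equivFin Ω
  let M : MixedCircuit n :=
    { anc := a
      size := Fintype.card Ω
      prob := fun i => p (e.symm i)
      prob_nonneg := fun i => hp _
      prob_sum := (e.symm.sum_comp p).trans hp1
      circuit := fun i => c (e.symm i) }
  have hM : M.channel = ∑ S, (p S : ℂ) • (c S).channel :=
    e.symm.sum_comp fun S => (p S : ℂ) • (c S).channel
  have ht : M.tCount ≤ k := Finset.sup_le fun i _ => hk _
  exact iInf_le_of_le M (iInf_le_of_le (by rw [hM]; exact hε) (by exact_mod_cast ht))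

theorem mixedTCount_toffoli_le {N m : ℕ} {ε : ℝ} (hε : 4 * (1 / 2 : ℝ) ^ m ≤ ε) :
    mixedTCount ε (toffoli (N + 1)) ≤ unitaryTCount 0 (toffoli (m + 1)) := by
  refine le_iInf fun a => le_iInf fun c => le_iInf fun hc => ?_
  rw [ENNReal.ofReal_zero, nonpos_iff_eq_zero] at hc
  have hc' := eq_of_diamondDist_eq_zero hc
  have hK0 : (Fintype.card (Fin m → Bits (Fin N)) : ℝ) ≠ 0 := by positivity
  let W : (Fin m → Bits (Fin N)) → Circuit (Fin (N + 1) ⊕ Fin (m + a)) :=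
    fun S => checksCircuit a S (List.finRange m)
  have hW : ∀ S, (W S).toOp = basisMap (xorMap fun x => Fin.append
      ((fun x j => check (S j) x : Bits (Fin N) → Bits (Fin m)) fun i => x i.castSucc)
        (zeros a)) := fun S => by
    simpa using toOp_checksCircuit a S (List.nodup_finRange m)
  have hp1 : ∑ _S : Fin m → Bits (Fin N), (Fintype.card (Fin m → Bits (Fin N)) : ℝ)⁻¹ = 1 := by
    rw [Finset.sum_const, Finset.card_univ, nsmul_eq_mul, mul_inv_cancel₀ hK0]
  refine mixedTCount_le (fun _ => by positivity) hp1
    (fun S => W S ++ c.map (Gate.map (placement N m a)) ++ W S) (fun S => ?_) ?_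
  · simp [W, Circuit.tCount_append, tCount_map, tCount_checksCircuit]
  · have hch : ∀ S, Circuit.channel (W S ++ c.map (Gate.map (placement N m a)) ++ W S)
        = unitaryChannel (basisMap (controlledFlip fun x j => check (S j) x)) := fun S =>
      channel_conj_toffoli (h := fun x j => check (S j) x) (hW S) hc'
    simp only [hch]
    have hunit : ∀ {l : ℕ} (h : Bits (Fin N) → Bits (Fin l)),
        (basisMap (controlledFlip h))ᴴ * basisMap (controlledFlip h) = 1 := fun h =>
      basisMap_conjTranspose_mul_self (controlledFlip_injective h)
    refine (diamondDist_mixture_le (fun _ => by positivity) hp1 (fun S => hunit _) ?_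
      (hunit fun _ => zeros 0) (by positivity) (average_controlledFlip N m)).trans
      (ENNReal.ofReal_le_ofReal hε)
    rw [toffoli_eq_controlledFlip]
    exact hunit _

end CliffordT

end

theorem theorem1 :
    (∀ (n : ℕ) (ε : ℝ), 1 ≤ n → 0 < ε →
      CliffordT.mixedTCount ε (CliffordT.toffoli n) ≤
        CliffordT.unitaryTCount 0 (CliffordT.toffoli (⌈Real.logb 2 (1 / ε)⌉ + 3).toNat)) ∧
    (∃ C : ℝ, ∀ ε : ℝ, 0 < ε →
      ∃ k : ℕ,
        CliffordT.unitaryTCount 0 (CliffordT.toffoli (⌈Real.logb 2 (1 / ε)⌉ + 3).toNat) = k ∧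
        (k : ℝ) ≤ C * max 1 (Real.logb 2 (1 / ε))) := by
  constructor
  · intro n ε hn hε
    obtain ⟨N, rfl⟩ : ∃ N, n = N + 1 := ⟨n - 1, by omega⟩
    have hlog : 1 / ε = (2 : ℝ) ^ Real.logb 2 (1 / ε) :=
      (Real.rpow_logb (by norm_num) (by norm_num) (by positivity)).symm
    set L := Real.logb 2 (1 / ε) with hL
    have hle : L ≤ ⌈L⌉ := Int.le_ceil L
    -- `m` control bits suffice as soon as `L + 2 ≤ m`.
    have hm : ∀ m : ℕ, L + 2 ≤ m → 4 * (1 / 2 : ℝ) ^ m ≤ ε := by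
      intro m hm
      have h1 : (2 : ℝ) ^ (L + 2) ≤ 2 ^ (m : ℝ) :=
        Real.rpow_le_rpow_of_exponent_le (by norm_num) hm
      rw [Real.rpow_add (by norm_num), ← hlog, Real.rpow_natCast] at h1
      have h2 : (0 : ℝ) < 2 ^ m := by positivity
      rw [one_div, inv_pow, ← div_eq_mul_inv, div_le_iff₀ h2]
      have h3 : ε * (1 / ε * (2 : ℝ) ^ (2 : ℝ)) ≤ ε * 2 ^ m := mul_le_mul_of_nonneg_left h1 hε.le
      rw [← mul_assoc, mul_one_div_cancel hε.ne'] at h3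
      norm_num at h3
      exact h3
    by_cases hpos : 1 ≤ ⌈L⌉ + 3
    · obtain ⟨m, hm'⟩ : ∃ m : ℕ, ⌈L⌉ + 3 = (m + 1 : ℕ) := ⟨(⌈L⌉ + 2).toNat, by omega⟩
      rw [hm', Int.toNat_natCast]
      refine CliffordT.mixedTCount_toffoli_le (hm m ?_)
      have h4 : ((⌈L⌉ + 3 : ℤ) : ℝ) = ((m + 1 : ℕ) : ℤ) := by rw [hm']
      push_cast at h4
      linarith
    · -- Here `ε > 4`, and the NOT gate on the target, which needs no `T` gate, is close enough.
      have hneg : ((⌈L⌉ : ℤ) : ℝ) ≤ -3 := by exact_mod_cast (by omega : ⌈L⌉ ≤ -3)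
      have h0 := CliffordT.mixedTCount_toffoli_le (N := N) (hm 0 (by push_cast; linarith))
      exact (h0.trans (CliffordT.unitaryTCount_toffoli_le 1)).trans bot_le
  · refine ⟨70, fun ε _ => ?_⟩
    set L := Real.logb 2 (1 / ε)
    have hb := CliffordT.unitaryTCount_toffoli_le (⌈L⌉ + 3).toNat
    obtain ⟨k, hk⟩ := ENat.ne_top_iff_exists.1 (ne_top_of_le_ne_top (ENat.natCast_ne_top _) hb)
    refine ⟨k, hk.symm, ?_⟩
    rw [← hk] at hb
    have hk1 : k ≤ 14 * ((⌈L⌉ + 3).toNat - 1) := by exact_mod_cast hb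
    have hk2 : (k : ℤ) ≤ 14 * max 0 (⌈L⌉ + 3) := by omega
    have hk3 : (k : ℝ) ≤ 14 * max 0 ((⌈L⌉ : ℝ) + 3) := by exact_mod_cast hk2
    have hceil := Int.ceil_lt_add_one L
    have h1 := le_max_left 1 L
    have h2 := le_max_right 1 L
    have h3 : max 0 ((⌈L⌉ : ℝ) + 3) ≤ 5 * max 1 L := max_le (by linarith) (by linarith)
    linarith
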